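/- For a finite abelian group $G$ (written additively), let $\exp(G)$ be its exponent and let the Davenport constant $D(G)$ be the smallest positive integer $d$ such that every sequence of at least $d$ elements of $G$ contains a nonempty subsequence with sum zero. For integers $r>q\ge 0$ and $m\ge 1$, a delta-system of type $S(r,q,m)$ is a collection of $r$-element sets $e_1,\dots,e_m$ for which there is a set $Q$ with $|Q|=q$ and $e_i\cap e_j=Q$ for all $1\le i<j\le m$. Let $R(S(r,q,m),G)$ be the smallest positive integer $d$ such that for every map $c$ from the set of edges of the complete $r$-uniform hypergraph $K_d^{(r)}$ (the set of $r$-element subsets of a $d$-element set) to $G$ there is a delta-system $e_1,\dots,e_m$ of type $S(r,q,m)$ consisting of edges of $K_d^{(r)}$ with $\sum_{i=1}^m c(e_i)=0$. **Theorem.** Let $G$ be a finite abelian group, and let $r>q\ge 0$ and $m\ge |G|$ be integers with $\exp(G)\mid m$. Then $R(S(r,q,m),G)$ exists and $$(r-q)m+\max(q,\,D(G)-1)\ \le\ R(S(r,q,m),G)\ \le\ (r-q)m+\min\bigl((r-q)(D(G)-1),\,|G|-1\bigr)+q.$$ -/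

import Mathlib

/-- `HasZeroSum s`: the finite sequence `s` of elements of `G` has a nonempty subsequence
(given by its set of indices) with sum zero. -/
def HasZeroSum {G : Type*} [AddCommGroup G] {n : ℕ} (s : Fin n → G) : Prop :=
  ∃ I : Finset (Fin n), I.Nonempty ∧ ∑ i ∈ I, s i = 0

/-- The Davenport constant `D(G)`: the smallest positive integer `d` such that every sequence of
elements of `G` of length at least `d` contains a nonempty subsequence with sum zero. -/
noncomputable def davenport (G : Type*) [AddCommGroup G] : ℕ :=
  sInf {d : ℕ | 0 < d ∧ ∀ n : ℕ, d ≤ n → ∀ s : Fin n → G, HasZeroSum s}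

/-- The infimum defining `D(G)` is attained (so it is not a junk value) when `G` is finite. -/
theorem davenport_isLeast (G : Type*) [AddCommGroup G] [Finite G] :
    IsLeast {d : ℕ | 0 < d ∧ ∀ n : ℕ, d ≤ n → ∀ s : Fin n → G, HasZeroSum s}
      (davenport G) := by
  have hne : {d : ℕ | 0 < d ∧ ∀ n : ℕ, d ≤ n → ∀ s : Fin n → G, HasZeroSum s}.Nonempty := by
    classical
    have : Fintype G := Fintype.ofFinite G
    refine ⟨Fintype.card G, Fintype.card_pos, fun n hn s => ?_⟩
    let P : Fin (n + 1) → G := fun k => ∑ i : Fin n with i.val < k.val, s i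
    have key : ∀ a b : Fin (n + 1), a < b → P a = P b → HasZeroSum s := by
      intro a b hab h
      have hsub : (Finset.univ.filter fun i : Fin n => i.val < a.val) ⊆
          (Finset.univ.filter fun i : Fin n => i.val < b.val) := by
        intro i hi
        simp only [Finset.mem_filter, Finset.mem_univ, true_and] at hi ⊢
        exact hi.trans hab
      refine ⟨(Finset.univ.filter fun i : Fin n => i.val < b.val) \
        (Finset.univ.filter fun i : Fin n => i.val < a.val), ?_, ?_⟩
      · have hb : a.val < n := by
          have h1 : a.val < b.val := hab
          have h2 := b.isLt
          omega
        refine ⟨⟨a.val, hb⟩, ?_⟩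
        simp only [Finset.mem_sdiff, Finset.mem_filter, Finset.mem_univ, true_and]
        exact ⟨hab, lt_irrefl _⟩
      · have h3 := Finset.sum_sdiff (f := s) hsub
        have h4 : P a = ∑ i : Fin n with i.val < a.val, s i := rfl
        have h5 : P b = ∑ i : Fin n with i.val < b.val, s i := rfl
        rw [← h4, ← h5, h] at h3
        simpa using h3
    obtain ⟨a, b, hab, h⟩ := Fintype.exists_ne_map_eq_of_card_lt P (by simp; omega)
    rcases lt_or_gt_of_ne hab with h' | h'
    · exact key a b h' h
    · exact key b a h' h.symm
  exact ⟨Nat.sInf_mem hne, fun _ hd => Nat.sInf_le hd⟩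

/-- The edges of the complete `r`-uniform hypergraph `K_d^{(r)}` on the vertex set `Fin d`:
all `r`-element subsets of the vertex set. -/
abbrev KEdge (d r : ℕ) : Type := {e : Finset (Fin d) // e.card = r}

/-- The `r`-sets `e 0, …, e (m - 1)` form a delta-system of type `S(r, q, m)`: `q < r`, and there
is a set `Q` with `q` elements which is the intersection of any two of them. (As `q < r`, the
sets are automatically pairwise distinct.) -/
def IsDeltaSystem {d r : ℕ} (q m : ℕ) (e : Fin m → KEdge d r) : Prop :=
  q < r ∧ ∃ Q : Finset (Fin d), Q.card = q ∧ ∀ i j : Fin m, i < j → (e i).1 ∩ (e j).1 = Q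

/-- Every `G`-coloring of the edges of `K_d^{(r)}` admits a zero-sum delta-system of type
`S(r, q, m)`. -/
def ForcesZeroSumDelta (G : Type*) [AddCommGroup G] (r q m d : ℕ) : Prop :=
  ∀ c : KEdge d r → G, ∃ e : Fin m → KEdge d r, IsDeltaSystem q m e ∧ ∑ i, c (e i) = 0

/-- The zero-sum Ramsey number `R(S(r, q, m), G)`: the smallest positive integer `d` such that
every `G`-coloring of the edges of `K_d^{(r)}` admits a zero-sum delta-system of type
`S(r, q, m)`. -/
noncomputable def deltaRamsey (G : Type*) [AddCommGroup G] (r q m : ℕ) : ℕ :=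
  sInf {d : ℕ | 0 < d ∧ ForcesZeroSumDelta G r q m d}

/-! ### Zero-sum subsequences in finite abelian groups -/

/-! Upper bounds: fix a `q`-set `Q` and colour each `(r - q)`-set `e` outside `Q` by `c (e ∪ Q)`. A
zero-sum matching of `m` such sets, enlarged by `Q`, is a zero-sum delta-system, so everything
reduces to matchings. With `m + D(G) - 1` disjoint edges available, Gao's theorem
(`exists_zero_sum_card_of_davenport`) selects `m` of sum zero. For the bound with `|G| - 1`, blocks
of `exp(G)` edges of sum zero are split off until `m = |G|`. That case is an induction through a
subgroup `H`: zero-sum matchings over `G ⧸ H` become the edges of a hypergraph coloured by `H`. If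
no proper nontrivial subgroup exists, take a maximum family of disjoint switches, sets of `r + 1`
vertices that offer two colours. By Cauchy-Davenport, `|G| - 1` switches reach every sum; with
fewer, the remaining vertices are monochromatic and the switches can be exchanged until each
contains an edge of that one colour.

Lower bound: colour an edge by the sum of its vertex weights. The kernel is counted `m` times and
cancels since `exp(G) ∣ m`. The petals cover `(r - q)m` vertices; if all but `(r - q)m - 1` vertices
carry a zero-sum free sequence, their total weight is not zero. -/

/-- Scherk's theorem: if `0` is represented only trivially in `A + B`, then
`|A| + |B| ≤ |A + B| + 1`. -/
theorem card_add_card_le_of_unique_zero {G : Type*} [AddCommGroup G] [Finite G] [DecidableEq G]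
    (A B : Finset G) (hA : 0 ∈ A) (hB : 0 ∈ B)
    (h : ∀ a ∈ A, ∀ b ∈ B, a + b = 0 → a = 0 ∧ b = 0) :
    A.card + B.card ≤ (Finset.image₂ (· + ·) A B).card + 1 := by
  induction hn : B.card using Nat.strong_induction_on generalizing A B with
  | _ n ih =>
    subst hn
    by_cases hB0 : ∃ b ∈ B, b ≠ 0
    · obtain ⟨b, hb, hb0⟩ := hB0
      -- Otherwise `A` contains all multiples of `b`, among them `-b`, against the uniqueness of the
      -- representation of zero.
      obtain ⟨a, ha, hab⟩ : ∃ a ∈ A, a + b ∉ A := by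
        by_contra! hcl
        have hmul : ∀ k : ℕ, k • b ∈ A := by
          intro k
          induction k with
          | zero => simpa using hA
          | succ k ihk => rw [succ_nsmul]; exact hcl _ ihk
        have hpos : 0 < addOrderOf b := addOrderOf_pos b
        have hsum : (addOrderOf b - 1) • b + b = 0 := by
          rw [← succ_nsmul, Nat.sub_add_cancel hpos, addOrderOf_nsmul_eq_zero]
        exact hb0 (h _ (hmul _) b hb hsum).2
      -- Dyson transform: the translates `a + x` missing from `A` move from `B` into `A`. The total
      -- size is kept, the sumset does not grow, and `B` loses `b`.
      set B' := B.filter fun x => a + x ∈ A with hB'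
      set A' := A ∪ B.image (a + ·) with hA'
      have hlt : B'.card < B.card :=
        Finset.card_lt_card (Finset.filter_ssubset.2 ⟨b, hb, hab⟩)
      have hcard : A'.card + B'.card = A.card + B.card := by
        have h1 := Finset.card_union_add_card_inter A (B.image (a + ·))
        have h2 : A ∩ B.image (a + ·) = B'.image (a + ·) := by
          ext x
          simp only [hB', Finset.mem_inter, Finset.mem_image, Finset.mem_filter]
          constructor
          · rintro ⟨hx, y, hy, rfl⟩
            exact ⟨y, ⟨hy, hx⟩, rfl⟩
          · rintro ⟨y, ⟨hy, hx⟩, rfl⟩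
            exact ⟨hx, y, hy, rfl⟩
        rw [h2, Finset.card_image_of_injective _ (add_right_injective a),
          Finset.card_image_of_injective _ (add_right_injective a)] at h1
        exact h1
      have hsub : Finset.image₂ (· + ·) A' B' ⊆ Finset.image₂ (· + ·) A B := by
        rw [Finset.image₂_subset_iff]
        intro x hx y hy
        simp only [hB', Finset.mem_filter] at hy
        rcases Finset.mem_union.1 hx with hx | hx
        · exact Finset.mem_image₂_of_mem hx hy.1
        · obtain ⟨z, hz, rfl⟩ := Finset.mem_image.1 hx
          refine Finset.mem_image₂.2 ⟨a + y, hy.2, z, hz, ?_⟩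
          abel
      have key := ih _ hlt A' B' (Finset.mem_union_left _ hA)
        (by simp only [hB', Finset.mem_filter]; exact ⟨hB, by simpa using ha⟩) (by
          intro x hx y hy hxy
          simp only [hB', Finset.mem_filter] at hy
          rcases Finset.mem_union.1 hx with hx | hx
          · exact h x hx y hy.1 hxy
          · obtain ⟨z, hz, rfl⟩ := Finset.mem_image.1 hx
            -- Regroup `(a + z) + y` as `(a + y) + z`, where `a + y ∈ A`.
            have h1 := h (a + y) hy.2 z hz (by rw [← hxy]; abel)
            have h2 := h a ha y hy.1 h1.1
            simp [h1.2, h2.1, h2.2]) rfl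
      rw [hcard] at key
      exact key.trans (Nat.add_le_add_right (Finset.card_le_card hsub) 1)
    · push Not at hB0
      have hB1 : B = {0} := Finset.eq_singleton_iff_unique_mem.2 ⟨hB, hB0⟩
      simp [hB1]

/-- A finite set on which every value of `a` is attained at most `h` times can be coloured with
`h` colours such that `a` is injective on each colour class. -/
theorem exists_coloring_injOn {ι G : Type*} (a : ι → G) (T : Finset ι) (h : ℕ)
    [DecidableEq G] (hh : ∀ g, (T.filter fun i => a i = g).card ≤ h) :
    ∃ f : ι → ℕ, (∀ i ∈ T, f i < h) ∧
      ∀ i ∈ T, ∀ j ∈ T, f i = f j → a i = a j → i = j := by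
  classical
  -- `F g` numbers the fibre of `a` over `g`; the value `0` off the fibre is never used.
  let F : G → ι → ℕ := fun g i => if hi : i ∈ T.filter fun j => a j = g then
    ((T.filter fun j => a j = g).equivFin ⟨i, hi⟩).val else 0
  have hF : ∀ g i (hi : i ∈ T.filter fun j => a j = g),
      F g i = ((T.filter fun j => a j = g).equivFin ⟨i, hi⟩).val := fun g i hi => dif_pos hi
  refine ⟨fun i => F (a i) i, ?_, ?_⟩
  · intro i hi
    have : i ∈ T.filter fun j => a j = a i := by simp [hi]
    beta_reduce
    rw [hF _ _ this]
    exact (Fin.is_lt _).trans_le (hh _)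
  · intro i hi j hj hf hij
    have h1 : i ∈ T.filter fun k => a k = a j := by simp [hi, hij]
    have h2 : j ∈ T.filter fun k => a k = a j := by simp [hj]
    beta_reduce at hf
    rw [hij, hF _ _ h1, hF _ _ h2] at hf
    simpa using (Equiv.injective _ (Fin.ext hf))

/-- A sequence of length at least `|G|` in which every element occurs at most `h` times has a
nonempty zero-sum subsequence of length at most `h`. -/
theorem exists_short_zero_sum {ι G : Type*} [AddCommGroup G] [Finite G] [DecidableEq G]
    (a : ι → G) (T : Finset ι) (h : ℕ) (hT : Nat.card G ≤ T.card)
    (hh : ∀ g, (T.filter fun i => a i = g).card ≤ h) :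
    ∃ U ⊆ T, U.Nonempty ∧ U.card ≤ h ∧ ∑ i ∈ U, a i = 0 := by
  classical
  by_contra! hno
  obtain ⟨f, hf, hinj⟩ := exists_coloring_injOn a T h hh
  -- Take at most one term from each colour class, so lengths stay at most `h`. A class `F`
  -- contributes the summand `{0} ∪ a(F)`, and Scherk's theorem adds at least `|F|` sums. After `h`
  -- classes there would be `|T| + 1 > |G|` sums.
  have key : ∀ k ≤ h, ∃ S : Finset G, 0 ∈ S ∧ (T.filter fun i => f i < k).card + 1 ≤ S.card ∧
      ∀ g ∈ S, ∃ U ⊆ T.filter fun i => f i < k, U.card ≤ k ∧ ∑ i ∈ U, a i = g ∧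
        (g = 0 → U = ∅) := by
    intro k
    induction k with
    | zero =>
      intro _
      exact ⟨{0}, by simp, by simp, fun g hg => ⟨∅, by simp, by simp, by simpa using (Finset.mem_singleton.1 hg).symm,
        fun _ => rfl⟩⟩
    | succ k ih =>
      intro hk
      obtain ⟨S, h0, hcard, hS⟩ := ih (by omega)
      set F := T.filter fun i => f i = k with hF
      have hsplit : (T.filter fun i => f i < k + 1) = (T.filter fun i => f i < k) ∪ F := by
        ext i
        simp only [hF, Finset.mem_filter, Finset.mem_union]
        constructor
        · rintro ⟨h1, h2⟩
          rcases Nat.lt_succ_iff_lt_or_eq.1 h2 with h3 | h3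
          · exact Or.inl ⟨h1, h3⟩
          · exact Or.inr ⟨h1, h3⟩
        · rintro (⟨h1, h2⟩ | ⟨h1, h2⟩)
          · exact ⟨h1, by omega⟩
          · exact ⟨h1, by omega⟩
      have hdisj : Disjoint (T.filter fun i => f i < k) F := by
        rw [Finset.disjoint_left]
        intro i hi hi'
        simp only [hF, Finset.mem_filter] at hi hi'
        omega
      have hFT : ∀ i ∈ F, i ∈ T := fun i hi => (Finset.mem_filter.1 hi).1
      have hF0 : ∀ i ∈ F, a i ≠ 0 := fun i hi h0 =>
        hno {i} (by simpa using hFT i hi) (by simp) (by simp; omega) (by simpa using h0)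
      have hAcard : (insert 0 (F.image a)).card = F.card + 1 := by
        rw [Finset.card_insert_of_notMem (by simpa using hF0), Finset.card_image_of_injOn]
        intro i hi j hj hij
        have hi' := Finset.mem_filter.1 (Finset.mem_coe.1 hi)
        have hj' := Finset.mem_filter.1 (Finset.mem_coe.1 hj)
        exact hinj i hi'.1 j hj'.1 (hi'.2.trans hj'.2.symm) hij
      have hrep : ∀ x ∈ S, ∀ y ∈ insert 0 (F.image a),
          ∃ U ⊆ T.filter fun i => f i < k + 1, U.card ≤ k + 1 ∧ ∑ i ∈ U, a i = x + y ∧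
            (U = ∅ → x = 0 ∧ y = 0) := by
        intro x hx y hy
        obtain ⟨U, hU, hUc, hUs, hU0⟩ := hS x hx
        rcases Finset.mem_insert.1 hy with rfl | hy
        · refine ⟨U, hU.trans (by rw [hsplit]; exact Finset.subset_union_left), by omega,
            by simpa using hUs, fun h1 => ⟨?_, rfl⟩⟩
          rw [← hUs, h1, Finset.sum_empty]
        · obtain ⟨i, hi, rfl⟩ := Finset.mem_image.1 hy
          have hiU : i ∉ U := fun hiU => Finset.disjoint_left.1 hdisj (hU hiU) hi
          refine ⟨insert i U, ?_, ?_, ?_, fun h1 => absurd h1 (by simp)⟩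
          · rw [hsplit]
            exact Finset.insert_subset (Finset.mem_union_right _ hi)
              (hU.trans Finset.subset_union_left)
          · rw [Finset.card_insert_of_notMem hiU]; omega
          · rw [Finset.sum_insert hiU, hUs, add_comm]
      have hempty : ∀ U ⊆ T.filter fun i => f i < k + 1, U.card ≤ k + 1 → ∑ i ∈ U, a i = 0 →
          U = ∅ := by
        intro U hU hUc hUs
        by_contra hne
        exact hno U (hU.trans (Finset.filter_subset _ _)) (Finset.nonempty_iff_ne_empty.2 hne)
          (by omega) hUs
      refine ⟨Finset.image₂ (· + ·) S (insert 0 (F.image a)), ?_, ?_, ?_⟩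
      · exact Finset.mem_image₂.2 ⟨0, h0, 0, by simp, by simp⟩
      · have hsch := card_add_card_le_of_unique_zero S (insert 0 (F.image a)) h0 (by simp) (by
          intro x hx y hy hxy
          obtain ⟨U, hU, hUc, hUs, hU0⟩ := hrep x hx y hy
          exact hU0 (hempty U hU hUc (hUs.trans hxy)))
        rw [hsplit, Finset.card_union_of_disjoint hdisj]
        omega
      · intro g hg
        obtain ⟨x, hx, y, hy, rfl⟩ := Finset.mem_image₂.1 hg
        obtain ⟨U, hU, hUc, hUs, hU0⟩ := hrep x hx y hy
        exact ⟨U, hU, hUc, hUs, fun h1 => hempty U hU hUc (hUs.trans h1)⟩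
  obtain ⟨S, -, hS, -⟩ := key h le_rfl
  have hall : (T.filter fun i => f i < h) = T := Finset.filter_true_of_mem hf
  have hle : S.card ≤ Nat.card G := by
    have := Fintype.ofFinite G
    rw [Nat.card_eq_fintype_card]
    exact Finset.card_le_univ S
  rw [hall] at hS
  omega

/-- Every sequence of length at least `D(G)` has a nonempty zero-sum subsequence. -/
theorem exists_zero_sum_of_davenport_le {ι G : Type*} [AddCommGroup G] [Finite G]
    (a : ι → G) (T : Finset ι) (hT : davenport G ≤ T.card) :
    ∃ U ⊆ T, U.Nonempty ∧ ∑ i ∈ U, a i = 0 := by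
  classical
  obtain ⟨I, hI, hs⟩ := (davenport_isLeast G).1.2 T.card hT fun k => a (T.equivFin.symm k)
  refine ⟨I.map (T.equivFin.symm.toEmbedding.trans (Function.Embedding.subtype _)), ?_, ?_, ?_⟩
  · intro x hx
    obtain ⟨k, -, rfl⟩ := Finset.mem_map.1 hx
    exact (T.equivFin.symm k).2
  · simpa using hI
  · simpa using hs

/-- Shifting a sequence so that `0` becomes an element of maximal multiplicity does not change
the sums of subsequences whose length is a multiple of `exp(G)`. -/
theorem exists_zero_sum_card_of_max_zero {ι G : Type*} [AddCommGroup G] [Finite G]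
    [DecidableEq G] (T : Finset ι) (m : ℕ) (hm : AddMonoid.exponent G ∣ m)
    (H : ∀ b : ι → G,
      (∀ g, (T.filter fun i => b i = g).card ≤ (T.filter fun i => b i = 0).card) →
      ∃ U ⊆ T, U.card = m ∧ ∑ i ∈ U, b i = 0) (a : ι → G) :
    ∃ U ⊆ T, U.card = m ∧ ∑ i ∈ U, a i = 0 := by
  classical
  have := Fintype.ofFinite G
  obtain ⟨g₀, -, hg₀⟩ := Finset.exists_max_image (Finset.univ : Finset G)
    (fun g => (T.filter fun i => a i = g).card) ⟨0, Finset.mem_univ 0⟩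
  obtain ⟨U, hU, hUm, hs⟩ := H (fun i => a i - g₀) (by
    intro g
    simpa only [sub_eq_iff_eq_add, zero_add] using hg₀ (g + g₀) (Finset.mem_univ _))
  refine ⟨U, hU, hUm, ?_⟩
  have h0 : m • g₀ = 0 := by
    obtain ⟨k, rfl⟩ := hm
    rw [mul_comm, mul_nsmul', AddMonoid.exponent_nsmul_eq_zero, nsmul_zero]
  simpa [Finset.sum_sub_distrib, hUm, h0] using hs

/-- A zero-sum subsequence without zeros can be lengthened by zeros. -/
theorem exists_zero_sum_card_of_pad {ι G : Type*} [AddCommGroup G] [DecidableEq G]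
    (b : ι → G) (T P : Finset ι) (m : ℕ) (hP : P ⊆ T.filter fun i => b i ≠ 0)
    (hsum : ∑ i ∈ P, b i = 0) (hle : P.card ≤ m)
    (hge : m ≤ P.card + (T.filter fun i => b i = 0).card) :
    ∃ U ⊆ T, U.card = m ∧ ∑ i ∈ U, b i = 0 := by
  classical
  obtain ⟨Z, hZ, hZc⟩ := Finset.exists_subset_card_eq
    (show m - P.card ≤ (T.filter fun i => b i = 0).card by omega)
  have hdisj : Disjoint P Z := by
    rw [Finset.disjoint_left]
    intro i hi hi'
    exact (Finset.mem_filter.1 (hP hi)).2 (Finset.mem_filter.1 (hZ hi')).2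
  refine ⟨P ∪ Z, Finset.union_subset (hP.trans (Finset.filter_subset _ _))
    (hZ.trans (Finset.filter_subset _ _)), ?_, ?_⟩
  · rw [Finset.card_union_of_disjoint hdisj]; omega
  · rw [Finset.sum_union hdisj, hsum, zero_add]
    exact Finset.sum_eq_zero fun i hi => (Finset.mem_filter.1 (hZ hi)).2

/-- A sequence of length at least `|G| + exp(G) - 1` has a zero-sum subsequence of length
`exp(G)`. -/
theorem exists_zero_sum_card_exponent {ι G : Type*} [AddCommGroup G] [Finite G]
    (a : ι → G) (T : Finset ι) (hT : Nat.card G + AddMonoid.exponent G ≤ T.card + 1) :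
    ∃ U ⊆ T, U.card = AddMonoid.exponent G ∧ ∑ i ∈ U, a i = 0 := by
  classical
  refine exists_zero_sum_card_of_max_zero T _ dvd_rfl (fun b hb => ?_) a
  set e := AddMonoid.exponent G
  set h := (T.filter fun i => b i = 0).card with hh
  have hsplit : h + (T.filter fun i => b i ≠ 0).card = T.card :=
    Finset.card_filter_add_card_filter_not _
  obtain ⟨P, hP, hmax⟩ := Finset.exists_max_image
    ((T.filter fun i => b i ≠ 0).powerset.filter fun P => P.card ≤ e ∧ ∑ i ∈ P, b i = 0)
    Finset.card ⟨∅, by simp⟩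
  simp only [Finset.mem_filter, Finset.mem_powerset] at hP hmax
  obtain ⟨hPT, hPe, hPs⟩ := hP
  refine exists_zero_sum_card_of_pad b T P e hPT hPs hPe ?_
  by_contra! hlt
  -- If `|P| + h < e`, at least `|G|` nonzero terms remain outside `P`, and adding a zero-sum `W` of
  -- length at most `h` keeps the length below `e`.
  obtain ⟨W, hW, hWne, hWc, hWs⟩ := exists_short_zero_sum b ((T.filter fun i => b i ≠ 0) \ P) h
    (by rw [Finset.card_sdiff_of_subset hPT]; omega)
    (fun g => (Finset.card_le_card (Finset.filter_subset_filter _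
      (Finset.sdiff_subset.trans (Finset.filter_subset _ _)))).trans (hb g))
  have hdisj : Disjoint P W := (Finset.disjoint_sdiff).mono_right hW
  have h1 := hmax (P ∪ W) ⟨Finset.union_subset hPT (hW.trans Finset.sdiff_subset),
    by rw [Finset.card_union_of_disjoint hdisj]; omega,
    by rw [Finset.sum_union hdisj, hPs, hWs, zero_add]⟩
  rw [Finset.card_union_of_disjoint hdisj] at h1
  have := hWne.card_pos
  omega

/-- Gao's theorem: if `|G| ≤ m` and `exp(G) ∣ m`, then a sequence of length at least
`m + D(G) - 1` has a zero-sum subsequence of length `m`. -/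
theorem exists_zero_sum_card_of_davenport {ι G : Type*} [AddCommGroup G] [Finite G]
    (a : ι → G) (T : Finset ι) (m : ℕ) (hm : Nat.card G ≤ m) (he : AddMonoid.exponent G ∣ m)
    (hT : m + davenport G ≤ T.card + 1) :
    ∃ U ⊆ T, U.card = m ∧ ∑ i ∈ U, a i = 0 := by
  classical
  refine exists_zero_sum_card_of_max_zero T _ he (fun b hb => ?_) a
  set h := (T.filter fun i => b i = 0).card with hh
  have hsplit : h + (T.filter fun i => b i ≠ 0).card = T.card :=
    Finset.card_filter_add_card_filter_not _
  -- A longest zero-sum set of nonzero terms works: if `|P| + h < m`, at least `D(G)` nonzero terms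
  -- are left to extend it.
  have hexists : ∃ P ⊆ T.filter fun i => b i ≠ 0, ∑ i ∈ P, b i = 0 ∧ m ≤ P.card + h := by
    obtain ⟨P, hP, hmax⟩ := Finset.exists_max_image
      ((T.filter fun i => b i ≠ 0).powerset.filter fun P => ∑ i ∈ P, b i = 0)
      Finset.card ⟨∅, by simp⟩
    simp only [Finset.mem_filter, Finset.mem_powerset] at hP hmax
    obtain ⟨hPT, hPs⟩ := hP
    refine ⟨P, hPT, hPs, ?_⟩
    by_contra! hlt
    obtain ⟨W, hW, hWne, hWs⟩ := exists_zero_sum_of_davenport_le b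
      ((T.filter fun i => b i ≠ 0) \ P) (by rw [Finset.card_sdiff_of_subset hPT]; omega)
    have hdisj : Disjoint P W := (Finset.disjoint_sdiff).mono_right hW
    have h1 := hmax (P ∪ W) ⟨Finset.union_subset hPT (hW.trans Finset.sdiff_subset),
      by rw [Finset.sum_union hdisj, hPs, hWs, zero_add]⟩
    rw [Finset.card_union_of_disjoint hdisj] at h1
    have := hWne.card_pos
    omega
  obtain ⟨P₀, hP₀⟩ := hexists
  -- A shortest such `P` has length at most `m`: from more than `m ≥ |G|` terms a zero-sum `W` of
  -- length at most `h` could be removed, leaving more than `m - h` terms.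
  obtain ⟨P, hP, hmin⟩ := Finset.exists_min_image
    ((T.filter fun i => b i ≠ 0).powerset.filter fun P => ∑ i ∈ P, b i = 0 ∧ m ≤ P.card + h)
    Finset.card ⟨P₀, by simpa only [Finset.mem_filter, Finset.mem_powerset] using hP₀⟩
  simp only [Finset.mem_filter, Finset.mem_powerset] at hP hmin
  obtain ⟨hPT, hPs, hPm⟩ := hP
  refine exists_zero_sum_card_of_pad b T P m hPT hPs ?_ hPm
  by_contra! hlt
  obtain ⟨W, hW, hWne, hWc, hWs⟩ := exists_short_zero_sum b P h (by omega)
    (fun g => (Finset.card_le_card (Finset.filter_subset_filter _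
      (hPT.trans (Finset.filter_subset _ _)))).trans (hb g))
  have hsd := Finset.card_sdiff_of_subset hW
  have hWP := Finset.card_le_card hW
  have h1 := hmin (P \ W) ⟨Finset.sdiff_subset.trans hPT, by
    have := Finset.sum_sdiff (f := b) hW
    rw [hWs, hPs, add_zero] at this
    exact this, by omega⟩
  have := hWne.card_pos
  omega

/-! ### Matchings in complete uniform hypergraphs -/

/-- `IsMatching r X M`: `M` consists of pairwise disjoint `r`-element subsets of `X`. -/
structure IsMatching {α : Type*} (r : ℕ) (X : Finset α) (M : Finset (Finset α)) : Prop where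
  subset : ∀ e ∈ M, e ⊆ X
  card_eq : ∀ e ∈ M, e.card = r
  disjoint : ∀ e ∈ M, ∀ f ∈ M, e ≠ f → Disjoint e f

namespace IsMatching

variable {α : Type*} {r : ℕ} {X Y : Finset α} {M N : Finset (Finset α)}

theorem mono (h : IsMatching r X M) (hXY : X ⊆ Y) : IsMatching r Y M :=
  ⟨fun e he => (h.subset e he).trans hXY, h.card_eq, h.disjoint⟩

theorem subset_left (h : IsMatching r X M) (hN : N ⊆ M) : IsMatching r X N :=
  ⟨fun e he => h.subset e (hN he), fun e he => h.card_eq e (hN he),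
    fun e he f hf => h.disjoint e (hN he) f (hN hf)⟩

theorem empty : IsMatching r X ∅ := ⟨by simp, by simp, by simp⟩

theorem biUnion_subset [DecidableEq α] (h : IsMatching r X M) : M.biUnion id ⊆ X :=
  Finset.biUnion_subset.2 h.subset

theorem card_biUnion [DecidableEq α] (h : IsMatching r X M) :
    (M.biUnion id).card = r * M.card := by
  rw [Finset.card_biUnion (t := id) (fun e he f hf => h.disjoint e he f hf),
    Finset.sum_const_nat (f := fun e => (id e).card) (m := r)
      (fun e he => h.card_eq e he), mul_comm]

theorem card_sdiff [DecidableEq α] (h : IsMatching r X M) :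
    (X \ M.biUnion id).card + r * M.card = X.card := by
  rw [← h.card_biUnion]
  exact Finset.card_sdiff_add_card_eq_card h.biUnion_subset

/-- Matchings on disjoint vertex sets are disjoint. -/
theorem disjoint_of_disjoint (hr : 0 < r) (hM : IsMatching r X M) (hN : IsMatching r Y N)
    (hXY : Disjoint X Y) : Disjoint M N := by
  rw [Finset.disjoint_left]
  intro e he he'
  have h1 : Disjoint e e := (hXY.mono_left (hM.subset e he)).mono_right (hN.subset e he')
  rw [Finset.disjoint_self_iff_empty] at h1
  have := hM.card_eq e he
  rw [h1, Finset.card_empty] at this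
  omega

theorem union [DecidableEq α] (hM : IsMatching r X M) (hN : IsMatching r Y N)
    (hXY : Disjoint X Y) : IsMatching r (X ∪ Y) (M ∪ N) := by
  refine ⟨?_, ?_, ?_⟩
  · intro e he
    rcases Finset.mem_union.1 he with he | he
    · exact (hM.subset e he).trans Finset.subset_union_left
    · exact (hN.subset e he).trans Finset.subset_union_right
  · intro e he
    rcases Finset.mem_union.1 he with he | he
    · exact hM.card_eq e he
    · exact hN.card_eq e he
  · intro e he f hf hne
    rcases Finset.mem_union.1 he with he | he <;> rcases Finset.mem_union.1 hf with hf | hf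
    · exact hM.disjoint e he f hf hne
    · exact (hXY.mono_left (hM.subset e he)).mono_right (hN.subset f hf)
    · exact ((hXY.mono_left (hM.subset f hf)).mono_right (hN.subset e he)).symm
    · exact hN.disjoint e he f hf hne

/-- Choosing a matching inside each block of a matching gives a matching. -/
theorem biUnion [DecidableEq α] {s : ℕ} (hM : IsMatching s X M)
    {φ : Finset α → Finset (Finset α)} (hφ : ∀ B ∈ M, IsMatching r B (φ B)) :
    IsMatching r X (M.biUnion φ) := by
  refine ⟨?_, ?_, ?_⟩
  · intro e he
    obtain ⟨B, hB, he⟩ := Finset.mem_biUnion.1 he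
    exact ((hφ B hB).subset e he).trans (hM.subset B hB)
  · intro e he
    obtain ⟨B, hB, he⟩ := Finset.mem_biUnion.1 he
    exact (hφ B hB).card_eq e he
  · intro e he f hf hne
    obtain ⟨B, hB, he⟩ := Finset.mem_biUnion.1 he
    obtain ⟨C, hC, hf⟩ := Finset.mem_biUnion.1 hf
    by_cases hBC : B = C
    · subst hBC
      exact (hφ B hB).disjoint e he f hf hne
    · exact ((hM.disjoint B hB C hC hBC).mono_left ((hφ B hB).subset e he)).mono_right
        ((hφ C hC).subset f hf)

/-- This makes sizes and sums over `M.biUnion φ` additive over the blocks; `0 < r` excludes the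
empty set as a common edge. -/
theorem pairwiseDisjoint [DecidableEq α] (hr : 0 < r) {s : ℕ} (hM : IsMatching s X M)
    {φ : Finset α → Finset (Finset α)} (hφ : ∀ B ∈ M, IsMatching r B (φ B)) :
    (M : Set (Finset α)).PairwiseDisjoint φ := fun B hB C hC hne =>
  disjoint_of_disjoint hr (hφ B hB) (hφ C hC) (hM.disjoint B hB C hC hne)

theorem singleton {e : Finset α} (he : e ⊆ X) (hc : e.card = r) : IsMatching r X {e} := by
  refine ⟨?_, ?_, ?_⟩ <;> simp [he, hc]

/-- Choosing an edge inside each block of a matching. -/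
theorem exists_of_choice [DecidableEq α] {G : Type*} [AddCommMonoid G] (c : Finset α → G)
    (hr : 0 < r) {s : ℕ} (hM : IsMatching s X M) {φ : Finset α → Finset α}
    (hφ : ∀ B ∈ M, φ B ⊆ B ∧ (φ B).card = r) :
    ∃ N, IsMatching r (M.biUnion id) N ∧ N.card = M.card ∧
      (∀ e ∈ N, ∃ B ∈ M, e = φ B) ∧ ∑ e ∈ N, c e = ∑ B ∈ M, c (φ B) := by
  have hs : ∀ B ∈ M, IsMatching r B {φ B} := fun B hB => singleton (hφ B hB).1 (hφ B hB).2
  have hM' : IsMatching s (M.biUnion id) M :=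
    ⟨fun e he => Finset.subset_biUnion_of_mem id he, hM.card_eq, hM.disjoint⟩
  have hd := pairwiseDisjoint hr hM hs
  refine ⟨M.biUnion fun B => {φ B}, hM'.biUnion hs, ?_, ?_, ?_⟩
  · rw [Finset.card_biUnion hd]; simp
  · intro e he
    simpa using he
  · rw [Finset.sum_biUnion hd]; simp

end IsMatching

/-- A set with at least `r * t` elements contains a matching of size `t`. -/
theorem exists_isMatching_card {α : Type*} {r : ℕ} (hr : 0 < r) (t : ℕ) (X : Finset α)
    (hX : r * t ≤ X.card) : ∃ M, IsMatching r X M ∧ M.card = t := by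
  classical
  induction t generalizing X with
  | zero => exact ⟨∅, IsMatching.empty, rfl⟩
  | succ t ih =>
    rw [Nat.mul_succ] at hX
    obtain ⟨e, he, hc⟩ := Finset.exists_subset_card_eq (show r ≤ X.card by omega)
    obtain ⟨M, hM, hMc⟩ := ih (X \ e) (by rw [Finset.card_sdiff_of_subset he]; omega)
    have h1 : IsMatching r e {e} := IsMatching.singleton subset_rfl hc
    have hd : Disjoint e (X \ e) := Finset.disjoint_sdiff
    refine ⟨{e} ∪ M, (h1.union hM hd).mono (Finset.union_subset he Finset.sdiff_subset), ?_⟩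
    rw [Finset.card_union_of_disjoint (IsMatching.disjoint_of_disjoint hr h1 hM hd), hMc,
      Finset.card_singleton, add_comm]

/-! ### Switches and zero-sum matchings -/

/-- A set of `r + 1` vertices whose `r`-subsets do not all have the same colour. -/
def IsSwitch {α G : Type*} (c : Finset α → G) (r : ℕ) (B : Finset α) : Prop :=
  B.card = r + 1 ∧ ∃ e f, e ⊆ B ∧ f ⊆ B ∧ e.card = r ∧ f.card = r ∧ c e ≠ c f

/-- Between an edge `f` of colour `c f` and an edge `e` of another colour there is a switch which
contains an edge of colour `c f`. -/
theorem exists_switch_subset_union {α G : Type*} [DecidableEq α] (c : Finset α → G) {r : ℕ}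
    {e f : Finset α} (he : e.card = r) (hf : f.card = r) (hne : c e ≠ c f) :
    ∃ B ⊆ e ∪ f, IsSwitch c r B ∧ (∃ g ⊆ B, g.card = r ∧ c g = c f) ∧ ∃ x ∈ B, x ∈ e ∧ x ∉ f := by
  classical
  -- Among the `r`-sets in `e ∪ f` not coloured `c f`, take the one closest to `f`. Exchanging one
  -- vertex moves it closer still, so the result has colour `c f`; the union of both sets is the
  -- switch.
  obtain ⟨g, hg, hmax⟩ := Finset.exists_max_image
    ((e ∪ f).powerset.filter fun g => g.card = r ∧ c g ≠ c f) (fun g => (g ∩ f).card)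
    ⟨e, Finset.mem_filter.2 ⟨Finset.mem_powerset.2 Finset.subset_union_left, he, hne⟩⟩
  simp only [Finset.mem_filter, Finset.mem_powerset] at hg hmax
  obtain ⟨hgs, hgc, hgne⟩ := hg
  have hgf : g ≠ f := fun h => hgne (by rw [h])
  obtain ⟨y, hy, hyf⟩ : ∃ y ∈ g, y ∉ f := by
    by_contra! h
    exact hgf (Finset.eq_of_subset_of_card_le h (by omega))
  obtain ⟨x, hx, hxg⟩ : ∃ x ∈ f, x ∉ g := by
    by_contra! h
    exact hgf (Finset.eq_of_subset_of_card_le h (by omega)).symm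
  have hxe : x ∉ g.erase y := fun h => hxg (Finset.mem_of_mem_erase h)
  have hg'c : (insert x (g.erase y)).card = r := by
    rw [Finset.card_insert_of_notMem hxe, Finset.card_erase_of_mem hy, hgc]
    have := Finset.card_pos.2 ⟨y, hy⟩
    omega
  have hBs : insert x g ⊆ e ∪ f := Finset.insert_subset (Finset.mem_union_right _ hx) hgs
  have hg's : insert x (g.erase y) ⊆ insert x g :=
    Finset.insert_subset_insert _ (Finset.erase_subset _ _)
  have hg' : c (insert x (g.erase y)) = c f := by
    by_contra hcon
    have h1 := hmax _ ⟨hg's.trans hBs, hg'c, hcon⟩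
    have h2 : insert x (g ∩ f) ⊆ insert x (g.erase y) ∩ f := by
      intro z hz
      rcases Finset.mem_insert.1 hz with rfl | hz
      · exact Finset.mem_inter.2 ⟨Finset.mem_insert_self _ _, hx⟩
      · obtain ⟨hz1, hz2⟩ := Finset.mem_inter.1 hz
        refine Finset.mem_inter.2 ⟨Finset.mem_insert_of_mem (Finset.mem_erase.2 ⟨?_, hz1⟩), hz2⟩
        rintro rfl
        exact hyf hz2
    have h3 := Finset.card_le_card h2
    rw [Finset.card_insert_of_notMem (fun h => hxg (Finset.mem_inter.1 h).1)] at h3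
    omega
  refine ⟨insert x g, hBs, ⟨by rw [Finset.card_insert_of_notMem hxg, hgc], g, _,
    Finset.subset_insert _ _, hg's, hgc, hg'c, by rw [hg']; exact hgne⟩, ⟨_, hg's, hg'c, hg'⟩,
    y, Finset.mem_insert_of_mem hy, ?_, hyf⟩
  rcases Finset.mem_union.1 (hgs hy) with h | h
  · exact h
  · exact absurd h hyf

open scoped Pointwise in
/-- Pairwise disjoint switches in a group without small subgroups give many sums. -/
theorem exists_sums_of_switches {α G : Type*} [AddCommGroup G] [Finite G]
    (hG : ∀ H : AddSubgroup G, H = ⊥ ∨ H = ⊤) (c : Finset α → G) {r : ℕ}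
    (M : Finset (Finset α)) (hM : ∀ B ∈ M, IsSwitch c r B) (hc : Nat.card G ≤ M.card + 1) (g : G) :
    ∃ φ : Finset α → Finset α, (∀ B ∈ M, φ B ⊆ B ∧ (φ B).card = r) ∧
      ∑ B ∈ M, c (φ B) = g := by
  classical
  have := Fintype.ofFinite G
  -- Each switch adds a two-element summand, so the set of sums grows by at least one until it fills
  -- `G`.
  have key : ∀ N ⊆ M, ∃ S : Finset G, min (Nat.card G) (N.card + 1) ≤ S.card ∧
      ∀ g ∈ S, ∃ φ : Finset α → Finset α, (∀ B ∈ N, φ B ⊆ B ∧ (φ B).card = r) ∧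
        ∑ B ∈ N, c (φ B) = g := by
    intro N
    induction N using Finset.induction_on with
    | empty =>
      intro _
      exact ⟨{0}, by simp, fun g hg => ⟨id, by simp, by simpa using (Finset.mem_singleton.1 hg).symm⟩⟩
    | insert B N hB ih =>
      intro hN
      obtain ⟨S, hS, hφ⟩ := ih ((Finset.subset_insert _ _).trans hN)
      obtain ⟨-, e, f, heB, hfB, her, hfr, hef⟩ := hM B (hN (Finset.mem_insert_self _ _))
      refine ⟨S + ({c e, c f} : Finset G), ?_, ?_⟩
      · have hne : S.Nonempty := by
          rw [← Finset.card_pos]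
          have : 0 < Nat.card G := Nat.card_pos
          omega
        have h1 := cauchy_davenport_minOrder_add hne (Finset.insert_nonempty (c e) {c f})
        -- Every nonzero element generates `G`.
        have h2 : ((Nat.card G : ℕ) : ℕ∞) ≤ AddMonoid.minOrder G := by
          rw [AddMonoid.le_minOrder]
          intro a ha _
          rcases hG (AddSubgroup.zmultiples a) with h | h
          · exact absurd (AddSubgroup.zmultiples_eq_bot.1 h) ha
          · rw [← Nat.card_zmultiples a, h]
            simp
        rw [Finset.card_pair hef] at h1
        have h3 : Nat.card G ≤ (S + ({c e, c f} : Finset G)).card ∨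
            S.card + 2 - 1 ≤ (S + ({c e, c f} : Finset G)).card := by
          rcases min_le_iff.1 h1 with h | h
          · exact Or.inl (by exact_mod_cast h2.trans h)
          · exact Or.inr (by exact_mod_cast h)
        rw [Finset.card_insert_of_notMem hB]
        omega
      · intro g hg
        obtain ⟨x, hx, y, hy, rfl⟩ := Finset.mem_add.1 hg
        obtain ⟨φ, hφ1, hφ2⟩ := hφ x hx
        obtain ⟨d, hd1, hd2, rfl⟩ : ∃ d ⊆ B, d.card = r ∧ c d = y := by
          rcases Finset.mem_insert.1 hy with rfl | hy
          · exact ⟨e, heB, her, rfl⟩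
          · exact ⟨f, hfB, hfr, (Finset.mem_singleton.1 hy).symm⟩
        have hne : ∀ C ∈ N, C ≠ B := fun C hC h => hB (h ▸ hC)
        refine ⟨Function.update φ B d, ?_, ?_⟩
        · intro C hC
          rcases Finset.mem_insert.1 hC with rfl | hC
          · simpa using ⟨hd1, hd2⟩
          · rw [Function.update_of_ne (hne C hC)]
            exact hφ1 C hC
        · rw [Finset.sum_insert hB, Function.update_self, add_comm, ← hφ2]
          congr 1
          exact Finset.sum_congr rfl fun C hC => by rw [Function.update_of_ne (hne C hC)]
  obtain ⟨S, hS, hφ⟩ := key M subset_rfl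
  have huniv : S = Finset.univ := by
    rw [← Finset.card_eq_iff_eq_univ]
    refine le_antisymm (Finset.card_le_univ S) ?_
    rw [← Nat.card_eq_fintype_card]
    omega
  exact hφ g (huniv ▸ Finset.mem_univ g)

/-- Zero-sum matchings of size `|G|` when `G` has no proper nontrivial subgroup. -/
theorem exists_zero_sum_matching_of_simple {α G : Type*} [AddCommGroup G] [Finite G]
    (hG : ∀ H : AddSubgroup G, H = ⊥ ∨ H = ⊤) {r : ℕ} (hr : 0 < r) (c : Finset α → G)
    (X : Finset α) (hX : (r + 1) * Nat.card G ≤ X.card + 1) :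
    ∃ M, IsMatching r X M ∧ M.card = Nat.card G ∧ ∑ e ∈ M, c e = 0 := by
  classical
  set n := Nat.card G with hn
  have hn0 : 0 < n := Nat.card_pos
  obtain ⟨𝓑, h𝓑, hmax⟩ := Finset.exists_max_image
    (X.powerset.powerset.filter fun M => IsMatching (r + 1) X M ∧ ∀ B ∈ M, IsSwitch c r B)
    Finset.card ⟨∅, by simp [IsMatching.empty]⟩
  have hmem : ∀ M : Finset (Finset α), M ∈ (X.powerset.powerset.filter fun M =>
      IsMatching (r + 1) X M ∧ ∀ B ∈ M, IsSwitch c r B) ↔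
      (IsMatching (r + 1) X M ∧ ∀ B ∈ M, IsSwitch c r B) := by
    intro M
    rw [Finset.mem_filter, and_iff_right_iff_imp]
    rintro ⟨h, -⟩
    exact Finset.mem_powerset.2 fun e he => Finset.mem_powerset.2 (h.subset e he)
  simp only [hmem] at h𝓑 hmax
  by_cases hbig : n ≤ 𝓑.card + 1
  -- Outside `n - 1` switches at least `r` vertices remain, enough for one edge `f`; the switches
  -- are then set to the sum `-c f`.
  · obtain ⟨𝓒, h𝓒, h𝓒c⟩ := Finset.exists_subset_card_eq (show n - 1 ≤ 𝓑.card by omega)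
    have hm := h𝓑.1.subset_left h𝓒
    have hcard := hm.card_sdiff
    have hr1 : r ≤ (X \ 𝓒.biUnion id).card := by
      obtain ⟨k, hk⟩ : ∃ k, n = k + 1 := ⟨n - 1, by omega⟩
      rw [h𝓒c, hk, Nat.add_sub_cancel] at hcard
      rw [hk, Nat.mul_succ] at hX
      omega
    obtain ⟨f, hf, hfc⟩ := Finset.exists_subset_card_eq hr1
    obtain ⟨φ, hφ, hsum⟩ := exists_sums_of_switches hG c 𝓒 (fun B hB => h𝓑.2 B (h𝓒 hB))
      (by omega) (-c f)
    obtain ⟨N, hN, hNc, -, hNs⟩ := hm.exists_of_choice c hr hφ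
    have h1 : IsMatching r f {f} := IsMatching.singleton subset_rfl hfc
    have hd : Disjoint (𝓒.biUnion id) f := Finset.disjoint_sdiff.mono_right hf
    have hdM := IsMatching.disjoint_of_disjoint hr hN h1 hd
    refine ⟨N ∪ {f}, (hN.union h1 hd).mono (Finset.union_subset hm.biUnion_subset
      (hf.trans Finset.sdiff_subset)), ?_, ?_⟩
    · rw [Finset.card_union_of_disjoint hdM, hNc, h𝓒c, Finset.card_singleton]; omega
    · rw [Finset.sum_union hdM, hNs, hsum, Finset.sum_singleton, neg_add_cancel]
  · set s := 𝓑.card with hs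
    -- One edge will come from each of the `s` switches and `t + 2` from the vertices outside them.
    obtain ⟨t, ht⟩ : ∃ t, n = s + t + 2 := ⟨n - s - 2, by omega⟩
    have hYcard : ∀ M, IsMatching (r + 1) X M → M.card = s →
        r * (t + 2) + t + 1 ≤ (X \ M.biUnion id).card := by
      intro M hM hMs
      have h1 := hM.card_sdiff
      rw [hMs] at h1
      have h2 : (r + 1) * n = (r + 1) * s + (r * (t + 2) + (t + 2)) := by rw [ht]; ring
      omega
    -- Removing a switch of `r + 1` vertices from the rest still leaves an edge.
    have hbig2 : 2 * r + 1 ≤ r * (t + 2) + t + 1 := by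
      have : r * (t + 2) = r * t + 2 * r := by ring
      omega
    -- Two colours outside a maximum family would give a further disjoint switch.
    have hmono : ∀ M, IsMatching (r + 1) X M → (∀ B ∈ M, IsSwitch c r B) → M.card = s →
        ∀ e f, e ⊆ X \ M.biUnion id → f ⊆ X \ M.biUnion id → e.card = r → f.card = r →
          c e = c f := by
      intro M hM hMs hMc e f he hf hec hfc
      by_contra hne
      obtain ⟨B, hB, hBs, -⟩ := exists_switch_subset_union c hec hfc hne
      have hB' : B ⊆ X \ M.biUnion id := hB.trans (Finset.union_subset he hf)
      have h1 : IsMatching (r + 1) B {B} := IsMatching.singleton subset_rfl hBs.1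
      have hM' : IsMatching (r + 1) (M.biUnion id) M :=
        ⟨fun e he => Finset.subset_biUnion_of_mem id he, hM.card_eq, hM.disjoint⟩
      have hd : Disjoint (M.biUnion id) B := Finset.disjoint_sdiff.mono_right hB'
      have h2 := hmax (M ∪ {B}) ⟨(hM'.union h1 hd).mono (Finset.union_subset hM.biUnion_subset
        (hB'.trans Finset.sdiff_subset)), fun C hC => by
          rcases Finset.mem_union.1 hC with hC | hC
          · exact hMs C hC
          · rw [Finset.mem_singleton.1 hC]; exact hBs⟩
      rw [Finset.card_union_of_disjoint
        (IsMatching.disjoint_of_disjoint (Nat.succ_pos r) hM' h1 hd), hMc,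
        Finset.card_singleton] at h2
      omega
    -- `K` collects the switches containing an edge of the outside colour; it is enlarged one switch
    -- at a time, with `M` kept of maximum size.
    have hgood : ∀ j ≤ s, ∃ M K, IsMatching (r + 1) X M ∧ (∀ B ∈ M, IsSwitch c r B) ∧
        M.card = s ∧ K ⊆ M ∧ K.card = j ∧
        ∀ B ∈ K, ∀ f ⊆ X \ M.biUnion id, f.card = r → ∃ g ⊆ B, g.card = r ∧ c g = c f := by
      intro j
      induction j with
      | zero => exact fun _ => ⟨𝓑, ∅, h𝓑.1, h𝓑.2, rfl, by simp, rfl, by simp⟩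
      | succ j ih =>
        intro hj
        obtain ⟨M, K, hM, hMs, hMc, hK, hKc, hKg⟩ := ih (by omega)
        obtain ⟨B, hB, hBK⟩ : ∃ B ∈ M, B ∉ K := by
          by_contra! h
          have := Finset.card_le_card h
          omega
        set Y := X \ M.biUnion id with hY
        have hYc : r * (t + 2) + t + 1 ≤ Y.card := hYcard M hM hMc
        obtain ⟨f, hf, hfc⟩ := Finset.exists_subset_card_eq (show r ≤ Y.card by omega)
        obtain ⟨-, e, -, heB, -, hec, -, -⟩ := hMs B hB
        by_cases hef : c e = c f
        · refine ⟨M, insert B K, hM, hMs, hMc, Finset.insert_subset hB hK, ?_, ?_⟩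
          · rw [Finset.card_insert_of_notMem hBK, hKc]
          · intro C hC f' hf' hf'c
            rcases Finset.mem_insert.1 hC with rfl | hC
            · exact ⟨e, heB, hec, hef.trans (hmono M hM hMs hMc f f' hf hf' hfc hf'c)⟩
            · exact hKg C hC f' hf' hf'c
        obtain ⟨B', hB', hB's, ⟨g, hgB, hgc, hgf⟩, x, hxB', hxe, hxf⟩ :=
          exists_switch_subset_union c hec hfc hef
        have hBM : B ⊆ M.biUnion id := Finset.subset_biUnion_of_mem id hB
        have hBY : Disjoint B Y := (Finset.disjoint_sdiff).mono_left hBM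
        have hB'BY : B' ⊆ B ∪ Y := hB'.trans (Finset.union_subset_union heB hf)
        have hN : IsMatching (r + 1) ((M.erase B).biUnion id) (M.erase B) :=
          ⟨fun e he => Finset.subset_biUnion_of_mem id he,
            (hM.subset_left (Finset.erase_subset _ _)).card_eq,
            (hM.subset_left (Finset.erase_subset _ _)).disjoint⟩
        have hNM : (M.erase B).biUnion id ⊆ M.biUnion id :=
          Finset.biUnion_subset_biUnion_of_subset_left _ (Finset.erase_subset _ _)
        have hd : Disjoint ((M.erase B).biUnion id) B' := by
          refine Disjoint.mono_right hB'BY (Finset.disjoint_union_right.2 ⟨?_, ?_⟩)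
          · rw [Finset.disjoint_biUnion_left]
            intro C hC
            exact hM.disjoint C (Finset.mem_of_mem_erase hC) B hB (Finset.ne_of_mem_erase hC)
          · exact (Finset.disjoint_sdiff).mono_left hNM
        have h1 : IsMatching (r + 1) B' {B'} := IsMatching.singleton subset_rfl hB's.1
        have hdM := IsMatching.disjoint_of_disjoint (Nat.succ_pos r) hN h1 hd
        have hM' : IsMatching (r + 1) X (M.erase B ∪ {B'}) :=
          (hN.union h1 hd).mono (Finset.union_subset (hNM.trans hM.biUnion_subset)
            (hB'BY.trans (Finset.union_subset (hM.subset B hB) Finset.sdiff_subset)))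
        have hM's : ∀ C ∈ M.erase B ∪ {B'}, IsSwitch c r C := fun C hC => by
          rcases Finset.mem_union.1 hC with hC | hC
          · exact hMs C (Finset.mem_of_mem_erase hC)
          · rw [Finset.mem_singleton.1 hC]; exact hB's
        have hM'c : (M.erase B ∪ {B'}).card = s := by
          rw [Finset.card_union_of_disjoint hdM, Finset.card_erase_of_mem hB, hMc,
            Finset.card_singleton]
          omega
        have hsub : Y \ B' ⊆ X \ (M.erase B ∪ {B'}).biUnion id := by
          intro y hy
          obtain ⟨hyY, hyB'⟩ := Finset.mem_sdiff.1 hy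
          obtain ⟨hyX, hyM⟩ := Finset.mem_sdiff.1 hyY
          refine Finset.mem_sdiff.2 ⟨hyX, fun h => ?_⟩
          obtain ⟨C, hC, hyC⟩ := Finset.mem_biUnion.1 h
          rcases Finset.mem_union.1 hC with hC | hC
          · exact hyM (Finset.mem_biUnion.2 ⟨C, Finset.mem_of_mem_erase hC, hyC⟩)
          · rw [Finset.mem_singleton.1 hC] at hyC
            exact hyB' hyC
        have hYB' : r ≤ (Y \ B').card := by
          have h2 := Finset.le_card_sdiff B' Y
          have h3 := hB's.1
          omega
        obtain ⟨f₁, hf₁, hf₁c⟩ := Finset.exists_subset_card_eq hYB'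
        -- The edge `f₁` lies outside both the old and the new family, so the exchange does not
        -- change the outside colour.
        have hcol : ∀ f' ⊆ X \ (M.erase B ∪ {B'}).biUnion id, f'.card = r → c f' = c f :=
          fun f' hf' hf'c =>
            (hmono _ hM' hM's hM'c f' f₁ hf' (hf₁.trans hsub) hf'c hf₁c).trans
              (hmono M hM hMs hMc f₁ f (hf₁.trans Finset.sdiff_subset) hf hf₁c hfc)
        have hB'K : B' ∉ K := by
          intro h
          have h2 : B' ∈ M.erase B := Finset.mem_erase.2 ⟨fun h3 => hBK (h3 ▸ h), hK h⟩
          exact Finset.disjoint_left.1 hdM h2 (Finset.mem_singleton_self _)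
        refine ⟨M.erase B ∪ {B'}, insert B' K, hM', hM's, hM'c, ?_, ?_, ?_⟩
        · refine Finset.insert_subset (by simp) fun C hC => Finset.mem_union_left _
            (Finset.mem_erase.2 ⟨fun h => hBK (h ▸ hC), hK hC⟩)
        · rw [Finset.card_insert_of_notMem hB'K, hKc]
        · intro C hC f' hf' hf'c
          rw [hcol f' hf' hf'c]
          rcases Finset.mem_insert.1 hC with rfl | hC
          · exact ⟨g, hgB, hgc, hgf⟩
          · exact hKg C hC f hf hfc
    obtain ⟨M, K, hM, hMs, hMc, hK, hKc, hKg⟩ := hgood s le_rfl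
    obtain rfl : K = M := Finset.eq_of_subset_of_card_le hK (by omega)
    have hYc := hYcard K hM hMc
    obtain ⟨N, hN, hNc⟩ := exists_isMatching_card hr (t + 2) (X \ K.biUnion id) (by omega)
    obtain ⟨f, hf⟩ : N.Nonempty := by rw [← Finset.card_pos]; omega
    have hφ : ∀ B, ∃ g, B ∈ K → g ⊆ B ∧ g.card = r ∧ c g = c f := by
      intro B
      by_cases hB : B ∈ K
      · obtain ⟨g, hg⟩ := hKg B hB f (hN.subset f hf) (hN.card_eq f hf)
        exact ⟨g, fun _ => hg⟩
      · exact ⟨∅, fun h => absurd h hB⟩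
    choose φ hφ using hφ
    obtain ⟨P, hP, hPc, -, hPs⟩ := hM.exists_of_choice c hr
      (φ := φ) (fun B hB => ⟨(hφ B hB).1, (hφ B hB).2.1⟩)
    have hd : Disjoint (K.biUnion id) (X \ K.biUnion id) := Finset.disjoint_sdiff
    have hdM := IsMatching.disjoint_of_disjoint hr hP hN hd
    refine ⟨P ∪ N, (hP.union hN hd).mono (Finset.union_subset hM.biUnion_subset
      Finset.sdiff_subset), ?_, ?_⟩
    · rw [Finset.card_union_of_disjoint hdM]; omega
    · rw [Finset.sum_union hdM, hPs, Finset.sum_congr rfl fun B hB => (hφ B hB).2.2,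
        Finset.sum_congr rfl fun e he => hmono K hM hMs hMc e f (hN.subset e he)
          (hN.subset f hf) (hN.card_eq e he) (hN.card_eq f hf), Finset.sum_const,
        Finset.sum_const, ← add_nsmul, hNc, hMc, show s + (t + 2) = n by omega, hn]
      exact card_nsmul_eq_zero'

/-- Zero-sum matchings of size `|G|` in a complete `r`-uniform hypergraph on
`(r + 1)|G| - 1` vertices. -/
theorem exists_zero_sum_matching_card {α G : Type*} [AddCommGroup G] [Finite G]
    {r : ℕ} (hr : 0 < r) (c : Finset α → G)
    (X : Finset α) (hX : (r + 1) * Nat.card G ≤ X.card + 1) :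
    ∃ M, IsMatching r X M ∧ M.card = Nat.card G ∧ ∑ e ∈ M, c e = 0 := by
  classical
  induction hn : Nat.card G using Nat.strong_induction_on generalizing G r X with
  | _ n ih =>
    by_cases hG : ∀ H : AddSubgroup G, H = ⊥ ∨ H = ⊤
    · rw [← hn]
      exact exists_zero_sum_matching_of_simple hG hr c X hX
    push Not at hG
    obtain ⟨H, hbot, htop⟩ := hG
    have hmul : Nat.card G = Nat.card (G ⧸ H) * Nat.card H :=
      AddSubgroup.card_eq_card_quotient_mul_card_addSubgroup H
    have hH1 : 1 < Nat.card H := by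
      rw [Nat.one_lt_iff_ne_zero_and_ne_one]
      exact ⟨Nat.card_pos.ne', fun h => hbot (AddSubgroup.card_eq_one.1 h)⟩
    have hQ1 : 1 < Nat.card (G ⧸ H) := by
      rw [Nat.one_lt_iff_ne_zero_and_ne_one]
      exact ⟨Nat.card_pos.ne', fun h => htop (AddSubgroup.index_eq_one.1 h)⟩
    set a := Nat.card (G ⧸ H)
    set b := Nat.card H
    -- `k = (r + 1)a - 1` vertices suffice over `G ⧸ H`, and `(k + 1)b = (r + 1)ab` makes the count
    -- for `k`-uniform matchings over `H` exact.
    obtain ⟨k, hk⟩ : ∃ k, (r + 1) * a = k + 1 :=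
      ⟨(r + 1) * a - 1, (Nat.sub_add_cancel (Nat.mul_pos (Nat.succ_pos r) (by omega))).symm⟩
    have hk0 : 0 < k := by nlinarith
    have hchunk : ∀ C : Finset α, ∃ M, C.card = k →
        IsMatching r C M ∧ M.card = a ∧ ∑ e ∈ M, c e ∈ H := by
      intro C
      by_cases hC : C.card = k
      · obtain ⟨M, hM, hMc, hMs⟩ := ih a (by rw [← hn, hmul]; nlinarith) hr
          (fun e => (QuotientAddGroup.mk (c e) : G ⧸ H)) C (by rw [hC]; exact hk.le) rfl
        refine ⟨M, fun _ => ⟨hM, hMc, ?_⟩⟩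
        rw [← QuotientAddGroup.eq_zero_iff]
        rw [← hMs]
        exact map_sum (QuotientAddGroup.mk' H) _ _
      · exact ⟨∅, fun h => absurd h hC⟩
    choose φ hφ using hchunk
    obtain ⟨N, hN, hNc, hNs⟩ := ih b (by rw [← hn, hmul]; nlinarith) (r := k) hk0
      (fun C => if h : ∑ e ∈ φ C, c e ∈ H then (⟨_, h⟩ : H) else 0) X
      (by rw [← hk, mul_assoc, ← hmul]; exact hX) rfl
    have hφ' : ∀ C ∈ N, IsMatching r C (φ C) := fun C hC => (hφ C (hN.card_eq C hC)).1
    have hd := hN.pairwiseDisjoint hr hφ'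
    refine ⟨N.biUnion φ, hN.biUnion hφ', ?_, ?_⟩
    · rw [Finset.card_biUnion hd, Finset.sum_const_nat (m := a)
        (fun C hC => (hφ C (hN.card_eq C hC)).2.1), hNc, ← hn, hmul, mul_comm]
    · rw [Finset.sum_biUnion hd]
      have h1 := congrArg (H.subtype) hNs
      rw [map_sum, map_zero] at h1
      rw [← h1]
      refine Finset.sum_congr rfl fun C hC => ?_
      rw [dif_pos (hφ C (hN.card_eq C hC)).2.2]
      rfl

/-- Zero-sum matchings of size `m` in a complete `r`-uniform hypergraph on `rm + |G| - 1`
vertices, for `m ≥ |G|` divisible by `exp(G)`. -/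
theorem exists_zero_sum_matching {α G : Type*} [AddCommGroup G] [Finite G]
    {r : ℕ} (hr : 0 < r) (c : Finset α → G) (m : ℕ) (hm : Nat.card G ≤ m)
    (he : AddMonoid.exponent G ∣ m) (X : Finset α) (hX : r * m + Nat.card G ≤ X.card + 1) :
    ∃ M, IsMatching r X M ∧ M.card = m ∧ ∑ e ∈ M, c e = 0 := by
  classical
  induction m using Nat.strong_induction_on generalizing X with
  | _ m ih =>
    rcases hm.eq_or_lt with rfl | hlt
    · exact exists_zero_sum_matching_card hr c X (by rw [add_mul, one_mul]; exact hX)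
    have heG : AddMonoid.exponent G ∣ Nat.card G := AddGroup.exponent_dvd_nat_card
    have he0 : 0 < AddMonoid.exponent G := Nat.pos_of_dvd_of_pos heG Nat.card_pos
    have hc0 : 0 < Nat.card G := Nat.card_pos
    set e := AddMonoid.exponent G
    obtain ⟨m', rfl⟩ : ∃ m', m = m' + e := by
      obtain ⟨k, hk⟩ := he
      have : 0 < k := Nat.pos_of_ne_zero (by rintro rfl; omega)
      exact ⟨m - e, (Nat.sub_add_cancel (by rw [hk]; exact Nat.le_mul_of_pos_right _ this)).symm⟩
    have he' : e ∣ m' := (Nat.dvd_add_left dvd_rfl).1 he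
    -- Both numbers are multiples of `e`, so `|G| < m' + e` forces `|G| ≤ m'`.
    have hm' : Nat.card G ≤ m' := by
      obtain ⟨u, hu⟩ := heG
      obtain ⟨v, rfl⟩ := he'
      rw [hu] at hlt ⊢
      refine Nat.mul_le_mul_left _ ?_
      by_contra! h
      have : e * (v + 1) ≤ e * u := Nat.mul_le_mul_left _ h
      rw [Nat.mul_succ] at this
      omega
    rw [Nat.mul_add] at hX
    obtain ⟨N, hN, hNc⟩ := exists_isMatching_card hr (m' + e) X (by rw [Nat.mul_add]; omega)
    -- The matching has `m' + e ≥ |G| + e - 1` edges; the `e` chosen ones use up only `re` vertices.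
    obtain ⟨U, hU, hUc, hUs⟩ := exists_zero_sum_card_exponent c N (by omega)
    have hUm := hN.subset_left hU
    have hUX := hUm.card_sdiff
    rw [show U.card = e from hUc] at hUX
    obtain ⟨M, hM, hMc, hMs⟩ := ih m' (by omega) hm' he' (X \ U.biUnion id) (by omega)
    have hU' : IsMatching r (U.biUnion id) U :=
      ⟨fun e he => Finset.subset_biUnion_of_mem id he, hUm.card_eq, hUm.disjoint⟩
    have hd : Disjoint (X \ U.biUnion id) (U.biUnion id) := Finset.sdiff_disjoint
    have hdM := IsMatching.disjoint_of_disjoint hr hM hU' hd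
    refine ⟨M ∪ U, (hM.union hU' hd).mono (Finset.union_subset Finset.sdiff_subset
      hUm.biUnion_subset), ?_, ?_⟩
    · rw [Finset.card_union_of_disjoint hdM, hMc, hUc]
    · rw [Finset.sum_union hdM, hMs, hUs, add_zero]

/-- Zero-sum matchings of size `m` in a complete `r`-uniform hypergraph on `r(m + D(G) - 1)`
vertices, for `m ≥ |G|` divisible by `exp(G)`. -/
theorem exists_zero_sum_matching_of_davenport {α G : Type*} [AddCommGroup G] [Finite G]
    {r : ℕ} (hr : 0 < r) (c : Finset α → G) (m : ℕ) (hm : Nat.card G ≤ m)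
    (he : AddMonoid.exponent G ∣ m) (X : Finset α)
    (hX : r * m + r * (davenport G - 1) ≤ X.card) :
    ∃ M, IsMatching r X M ∧ M.card = m ∧ ∑ e ∈ M, c e = 0 := by
  obtain ⟨N, hN, hNc⟩ := exists_isMatching_card hr (m + (davenport G - 1)) X
    (by rw [Nat.mul_add]; exact hX)
  have hD : 0 < davenport G := (davenport_isLeast G).1.1
  obtain ⟨U, hU, hUc, hUs⟩ := exists_zero_sum_card_of_davenport c N m hm he (by omega)
  exact ⟨U, hN.subset_left hU, hUc, hUs⟩

/-! ### Delta-systems: reduction to matchings and the lower bound -/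

/-- There is a sequence of length `D(G) - 1` without nonempty zero-sum subsequences. -/
theorem exists_not_hasZeroSum (G : Type*) [AddCommGroup G] [Finite G] :
    ∃ s : Fin (davenport G - 1) → G, ¬ HasZeroSum s := by
  have hD := davenport_isLeast G
  -- The empty sequence serves when `D(G) = 1`; otherwise `D(G) - 1` is positive and minimality of
  -- `D(G)` applies.
  by_cases h1 : davenport G - 1 = 0
  · refine ⟨fun _ => 0, ?_⟩
    rintro ⟨I, ⟨i, -⟩, -⟩
    have := i.isLt
    omega
  · by_contra! hall
    have h2 : davenport G - 1 ∈
        {d : ℕ | 0 < d ∧ ∀ n : ℕ, d ≤ n → ∀ s : Fin n → G, HasZeroSum s} := by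
      refine ⟨by omega, fun n hn s => ?_⟩
      rcases hn.eq_or_lt with rfl | hlt
      · exact hall s
      · exact hD.1.2 n (by omega) s
    have := hD.2 h2
    omega

/-- Zero-sum matchings outside a fixed `q`-set yield zero-sum delta-systems. -/
theorem forcesZeroSumDelta_of_matching {G : Type*} [AddCommGroup G] {r q m d : ℕ} (hqr : q < r)
    (hq : q ≤ d)
    (H : ∀ (c : Finset (Fin d) → G) (X : Finset (Fin d)), X.card = d - q →
      ∃ M, IsMatching (r - q) X M ∧ M.card = m ∧ ∑ e ∈ M, c e = 0) :
    ForcesZeroSumDelta G r q m d := by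
  classical
  intro c
  obtain ⟨Q, -, hQ⟩ := Finset.exists_subset_card_eq
    (show q ≤ (Finset.univ : Finset (Fin d)).card by simpa using hq)
  obtain ⟨M, hM, hMc, hMs⟩ := H
    (fun e => if h : (e ∪ Q).card = r then c ⟨e ∪ Q, h⟩ else 0) (Finset.univ \ Q)
    (by rw [Finset.card_sdiff_of_subset (Finset.subset_univ Q)]; simp [hQ])
  have hdisj : ∀ e ∈ M, Disjoint e Q := fun e he =>
    (Finset.sdiff_disjoint (s := Q) (t := Finset.univ)).mono_left (hM.subset e he)
  have hcard : ∀ e ∈ M, (e ∪ Q).card = r := fun e he => by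
    rw [Finset.card_union_of_disjoint (hdisj e he), hM.card_eq e he, hQ]
    omega
  let E : Fin m ≃ M := (M.equivFinOfCardEq hMc).symm
  refine ⟨fun i => ⟨(E i).1 ∪ Q, hcard _ (E i).2⟩, ⟨hqr, Q, hQ, fun i j hij => ?_⟩, ?_⟩
  · have hne : (E i).1 ≠ (E j).1 := fun h => hij.ne (E.injective (Subtype.ext h))
    have h1 := hM.disjoint _ (E i).2 _ (E j).2 hne
    change ((E i).1 ∪ Q) ∩ ((E j).1 ∪ Q) = Q
    rw [← Finset.inter_union_distrib_right, Finset.disjoint_iff_inter_eq_empty.1 h1,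
      Finset.empty_union]
  · rw [← hMs, ← Finset.sum_coe_sort M, ← E.sum_comp]
    refine Finset.sum_congr rfl fun i _ => ?_
    rw [dif_pos (hcard _ (E i).2)]

/-- The petals of a delta-system, with a kernel contained in every edge. -/
theorem IsDeltaSystem.exists_kernel_subset {d r q m : ℕ} {e : Fin m → KEdge d r}
    (hm : 0 < m) (he : IsDeltaSystem q m e) :
    ∃ Q : Finset (Fin d), Q.card = q ∧ (∀ i, Q ⊆ (e i).1) ∧
      ∀ i j, i ≠ j → Disjoint ((e i).1 \ Q) ((e j).1 \ Q) := by
  obtain ⟨hqr, Q, hQ, hint⟩ := he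
  -- A single edge puts no condition on the given `Q`, so a `q`-subset of that edge replaces it.
  by_cases h1 : m = 1
  · subst h1
    obtain ⟨Q', hQ', hQ'c⟩ := Finset.exists_subset_card_eq
      (show q ≤ (e 0).1.card by rw [(e 0).2]; exact hqr.le)
    refine ⟨Q', hQ'c, fun i => ?_, fun i j hij => absurd (Subsingleton.elim i j) hij⟩
    rw [Subsingleton.elim i 0]
    exact hQ'
  · have hint' : ∀ i j, i ≠ j → (e i).1 ∩ (e j).1 = Q := by
      intro i j hij
      rcases lt_or_gt_of_ne hij with h | h
      · exact hint i j h
      · rw [Finset.inter_comm]; exact hint j i h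
    have : Nontrivial (Fin m) := Fin.nontrivial_iff_two_le.2 (by omega)
    refine ⟨Q, hQ, fun i => ?_, fun i j hij => ?_⟩
    · obtain ⟨j, hj⟩ := exists_ne i
      rw [← hint' i j hj.symm]
      exact Finset.inter_subset_left
    · rw [Finset.disjoint_left]
      intro x hx hx'
      obtain ⟨h2, h3⟩ := Finset.mem_sdiff.1 hx
      exact h3 (hint' i j hij ▸ Finset.mem_inter.2 ⟨h2, (Finset.mem_sdiff.1 hx').1⟩)

/-- The lower bound: a delta-system needs `(r - q)m + q` vertices, and weighting the vertices
outside a set of `(r - q)m - 1` vertices by a zero-sum free sequence prevents zero-sum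
delta-systems. -/
theorem ForcesZeroSumDelta.le {G : Type*} [AddCommGroup G] [Finite G] {r q m d : ℕ}
    (hqr : q < r) (hm : 0 < m) (he : AddMonoid.exponent G ∣ m)
    (h : ForcesZeroSumDelta G r q m d) :
    (r - q) * m + max q (davenport G - 1) ≤ d := by
  classical
  have hfree := exists_not_hasZeroSum G
  set D := davenport G - 1
  obtain ⟨s, hs⟩ := hfree
  set N := (r - q) * m with hN
  have hN0 : 0 < N := Nat.mul_pos (by omega) hm
  -- The first `N - 1` vertices get weight zero, one too few to hold all `N` petal vertices; the
  -- next `D` carry `s`.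
  let w : Fin d → G := fun v =>
    if hv : N - 1 ≤ v.val ∧ v.val - (N - 1) < D then s ⟨v.val - (N - 1), hv.2⟩ else 0
  obtain ⟨e, hdelta, hsum⟩ := h fun e => ∑ v ∈ e.1, w v
  obtain ⟨Q, hQ, hQe, hdis⟩ := hdelta.exists_kernel_subset hm
  set U := Finset.univ.biUnion fun i : Fin m => (e i).1 \ Q with hU
  have hUc : U.card = N := by
    rw [hU, Finset.card_biUnion fun i _ j _ hij => hdis i j hij,
      Finset.sum_const_nat (m := r - q) fun i _ => by
        rw [Finset.card_sdiff_of_subset (hQe i), (e i).2, hQ]]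
    simp [hN, mul_comm]
  have hUQ : Disjoint U Q := by
    rw [hU, Finset.disjoint_biUnion_left]
    exact fun i _ => Finset.sdiff_disjoint
  have hbound1 : N + q ≤ d := by
    have := Finset.card_le_univ (U ∪ Q)
    rw [Finset.card_union_of_disjoint hUQ, hUc, hQ, Fintype.card_fin] at this
    exact this
  have hUs : ∑ v ∈ U, w v = 0 := by
    rw [hU, Finset.sum_biUnion fun i _ j _ hij => hdis i j hij, ← hsum]
    -- The kernel enters the total once per edge, hence `m` times.
    have h0 : m • ∑ v ∈ Q, w v = 0 := by
      obtain ⟨k, hk⟩ := he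
      rw [hk, mul_comm, mul_nsmul', AddMonoid.exponent_nsmul_eq_zero, nsmul_zero]
    rw [← add_zero (∑ i : Fin m, ∑ v ∈ (e i).1 \ Q, w v), ← h0]
    simp_rw [← Finset.sum_sdiff (f := w) (hQe _)]
    rw [Finset.sum_add_distrib]
    simp
  refine le_trans (b := max (N + q) (N + D)) (by omega) (max_le hbound1 ?_)
  by_contra! hlt
  -- As `d < N + D`, every vertex past the first `N - 1` carries a term of `s`.
  have hlarge : ∀ v : Fin d, N - 1 ≤ v.val → v.val - (N - 1) < D := fun v hv => by
    have := v.isLt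
    omega
  set I : Finset (Fin D) := Finset.univ.filter fun k => ∃ v ∈ U, v.val = N - 1 + k.val with hI
  refine hs ⟨I, ?_, ?_⟩
  · obtain ⟨v, hvU, hv⟩ : ∃ v ∈ U, N - 1 ≤ v.val := by
      by_contra! hsmall
      have h1 : (U.image Fin.val).card ≤ (Finset.range (N - 1)).card :=
        Finset.card_le_card fun x hx => by
          obtain ⟨v, hv, rfl⟩ := Finset.mem_image.1 hx
          exact Finset.mem_range.2 (hsmall v hv)
      rw [Finset.card_image_of_injective _ Fin.val_injective, hUc, Finset.card_range] at h1
      omega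
    refine ⟨⟨v.val - (N - 1), hlarge v hv⟩, ?_⟩
    simp only [hI, Finset.mem_filter, Finset.mem_univ, true_and]
    exact ⟨v, hvU, by omega⟩
  · rw [← hUs, ← Finset.sum_filter_add_sum_filter_not U (fun v => N - 1 ≤ v.val),
      Finset.sum_eq_zero (s := U.filter fun v => ¬ N - 1 ≤ v.val), add_zero]
    · symm
      refine Finset.sum_bij (fun v hv => ⟨v.val - (N - 1),
        hlarge v (Finset.mem_filter.1 hv).2⟩) ?_ ?_ ?_ ?_
      · intro v hv
        obtain ⟨h1, h2⟩ := Finset.mem_filter.1 hv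
        simp only [hI, Finset.mem_filter, Finset.mem_univ, true_and]
        exact ⟨v, h1, by omega⟩
      · intro v hv v' hv' heq
        have h1 := (Finset.mem_filter.1 hv).2
        have h2 := (Finset.mem_filter.1 hv').2
        have h3 := Fin.mk.inj_iff.1 heq
        exact Fin.ext (by omega)
      · intro k hk
        simp only [hI, Finset.mem_filter, Finset.mem_univ, true_and] at hk
        obtain ⟨v, hv, hvk⟩ := hk
        exact ⟨v, Finset.mem_filter.2 ⟨hv, by omega⟩, Fin.ext (by simp only; omega)⟩
      · intro v hv
        have h2 := (Finset.mem_filter.1 hv).2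
        exact dif_pos (And.intro h2 (hlarge v h2))
    · intro v hv
      exact dif_neg fun h => (Finset.mem_filter.1 hv).2 h.1

/-- The first conjunct says that `R(S(r, q, m), G)` exists, i.e. that the infimum defining it is
attained. The natural-number subtractions never truncate: `q < r`, `1 ≤ D(G)`, `1 ≤ |G|`. -/
theorem theorem2 (G : Type*) [AddCommGroup G] [Finite G] (r q m : ℕ) (hqr : q < r)
    (hm : Nat.card G ≤ m) (hexp : AddMonoid.exponent G ∣ m) :
    IsLeast {d : ℕ | 0 < d ∧ ForcesZeroSumDelta G r q m d} (deltaRamsey G r q m) ∧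
    (r - q) * m + max q (davenport G - 1) ≤ deltaRamsey G r q m ∧
    deltaRamsey G r q m ≤
      (r - q) * m + min ((r - q) * (davenport G - 1)) (Nat.card G - 1) + q := by
  have hm0 : 0 < m := Nat.card_pos.trans_le hm
  have hr : 0 < r - q := Nat.sub_pos_of_lt hqr
  have hG : 0 < Nat.card G := Nat.card_pos
  have hupper : (r - q) * m + min ((r - q) * (davenport G - 1)) (Nat.card G - 1) + q ∈
      {d : ℕ | 0 < d ∧ ForcesZeroSumDelta G r q m d} := by
    refine ⟨?_, forcesZeroSumDelta_of_matching hqr (Nat.le_add_left _ _) fun c X hX => ?_⟩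
    · have := Nat.mul_pos hr hm0
      omega
    · rw [Nat.add_sub_cancel] at hX
      rcases le_total ((r - q) * (davenport G - 1)) (Nat.card G - 1) with h | h
      · exact exists_zero_sum_matching_of_davenport hr c m hm hexp X
          (by have := min_eq_left h; omega)
      · exact exists_zero_sum_matching hr c m hm hexp X
          (by have := min_eq_right h; omega)
  have hmem : deltaRamsey G r q m ∈ {d : ℕ | 0 < d ∧ ForcesZeroSumDelta G r q m d} :=
    Nat.sInf_mem ⟨_, hupper⟩
  exact ⟨⟨hmem, fun _ hd => Nat.sInf_le hd⟩, hmem.2.le hqr hm0 hexp, Nat.sInf_le hupper⟩
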